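/- **Definitions.** Let $n\ge 0$ be an integer and let $\mathbb T=\mathbb R\cup\{-\infty\}$. A *planar network of rank $n$* is a finite graph embedded in a strip $0\le x\le r$, $1\le y\le n$ (with $r>0$), whose edges are never vertical (each edge is drawn as the graph of a continuous function of $x$, and edges meet each other and the vertices only at their end points), such that there are exactly $n$ vertices on the line $x=0$ (the *sources*) and exactly $n$ vertices on the line $x=r$ (the *sinks*); both are numbered $1,\dots,n$ from bottom to top. Edges are oriented from left to right. A *$\mathbb T$-weighting* $w$ assigns to every edge an element of $\mathbb T$. For $a\in\mathbb N$, an *$a$-multipath* is a collection of $a$ pairwise non-intersecting (i.e. vertex-disjoint) oriented paths, each leading from a source to a sink; its weight is the sum of the weights of all edges of its paths. The *concatenation* $\Pi_1\circ\Pi_2$ of two networks of rank $n$ is obtained by identifying the $i$-th sink of $\Pi_1$ with the $i$-th source of $\Pi_2$ for all $i$, and it carries the weighting $w_1\circ w_2$ that restricts to $w_1$ and $w_2$. Let $(\Pi_1,w_1),(\Pi_2,w_2),(\Pi_3,w_3)$ be $\mathbb T$-weighted planar networks of rank $n$. For $i,j,k\in\mathbb N$, an *$(i,j,k)$-multipath*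 is a triple $(p_1,p_2,p_3)$, where $p_1$ is an $i$-multipath in $\Pi_1$, $p_2$ is a $j$-multipath in $\Pi_1\circ\Pi_2$ and $p_3$ is a $k$-multipath in $\Pi_1\circ\Pi_2\circ\Pi_3$, such that $p_1,p_2,p_3$ are pairwise non-intersecting in $\Pi_1\circ\Pi_2\circ\Pi_3$; its weight is the sum of the weights of $p_1,p_2,p_3$. Let $$\Delta^3(n)=\{(i,j,k)\in\mathbb Z_{\ge0}^3 : i+j+k\le n\},$$ and for $(i,j,k)\in\Delta^3(n)$ let $m_{i,j,k}\in\mathbb T$ be the maximal weight of an $(i,j,k)$-multipath, with $m_{i,j,k}=-\infty$ if there is none. The group $S_4$ acts on $\mathbb Z^3$ by permuting the coordinates of $(n-i-j-k,\,i,\,j,\,k)$, that is, by permuting the vertices of the tetrahedron $\Delta^3(n)$. A *small rhombus* in $\Delta^3(n)$ is a quadruple of points of $\Delta^3(n)$ obtained from $(0,0,0),(1,0,0),(1,1,0),(0,1,0)$ by an element of $S_4$ followed by a translation; its *long diagonal* consists of the images of $(0,0,0)$ and $(1,1,0)$, and its *short diagonal* of the images of $(1,0,0)$ and $(0,1,0)$.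 **Theorem.** For every small rhombus in $\Delta^3(n)$ with long diagonal $\beta_1,\beta_2$ and short diagonal $\alpha_1,\alpha_2$, $$m_{\alpha_1}+m_{\alpha_2}\ \ge\ m_{\beta_1}+m_{\beta_2}.$$ -/

import Mathlib

universe u

/-- A finite directed graph (multi-edges allowed) with `n` labelled sources and `n` labelled
sinks: the combinatorial structure underlying a planar network of rank `n`. -/
structure Network (n : ℕ) where
  V : Type u
  E : Type u
  finiteV : Finite V
  finiteE : Finite E
  src : E → V
  tgt : E → V
  source : Fin n → V
  sink : Fin n → V

/-- A planar network of rank `n`: a finite graph embedded in the strip `0 ≤ x ≤ r`, `1 ≤ y ≤ n`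
whose edges are never vertical. The edge `e` is drawn as the graph of the function `height e` over
the interval between the abscissas of its ends, and is oriented from left to right. The vertices
on the line `x = 0` are the sources and those on the line `x = r` are the sinks, both enumerated
from bottom to top. -/
structure PlanarNetwork (n : ℕ) extends Network.{u} n where
  r : ℝ
  r_pos : 0 < r
  x : V → ℝ
  y : V → ℝ
  height : E → ℝ → ℝ
  pos_injective : Function.Injective fun v => (x v, y v)
  x_mem : ∀ v, x v ∈ Set.Icc 0 r
  y_mem : ∀ v, y v ∈ Set.Icc 1 (n : ℝ)
  left_to_right : ∀ e, x (src e) < x (tgt e)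
  height_continuousOn : ∀ e, ContinuousOn (height e) (Set.Icc (x (src e)) (x (tgt e)))
  height_mem : ∀ e, ∀ s ∈ Set.Icc (x (src e)) (x (tgt e)), height e s ∈ Set.Icc 1 (n : ℝ)
  height_src : ∀ e, height e (x (src e)) = y (src e)
  height_tgt : ∀ e, height e (x (tgt e)) = y (tgt e)
  edge_avoids_vertex : ∀ e v, x v ∈ Set.Ioo (x (src e)) (x (tgt e)) → height e (x v) ≠ y v
  edge_avoids_edge : ∀ e f, e ≠ f → ∀ s ∈ Set.Ioo (x (src e)) (x (tgt e)),
    s ∈ Set.Ioo (x (src f)) (x (tgt f)) → height e s ≠ height f s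
  x_eq_zero_iff : ∀ v, x v = 0 ↔ v ∈ Set.range source
  x_eq_r_iff : ∀ v, x v = r ↔ v ∈ Set.range sink
  source_strictMono : StrictMono fun i => y (source i)
  sink_strictMono : StrictMono fun i => y (sink i)

namespace Network

variable {n : ℕ}

/-- `N.IsWalk u l v`: the list of edges `l` is an oriented walk from `u` to `v`. -/
def IsWalk (N : Network.{u} n) : N.V → List N.E → N.V → Prop
  | u, [], v => u = v
  | u, e :: l, v => N.src e = u ∧ N.IsWalk (N.tgt e) l v

/-- An oriented path from a source to a sink, given by its list of edges. (In a planar network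
vertices are never repeated along an oriented walk, so `nodup` holds automatically there.) -/
@[ext]
structure Path (N : Network.{u} n) where
  start : Fin n
  finish : Fin n
  edges : List N.E
  isWalk : N.IsWalk (N.source start) edges (N.sink finish)
  nodup : (N.source start :: edges.map N.tgt).Nodup

/-- The list of vertices of a path. -/
def Path.support {N : Network.{u} n} (p : N.Path) : List N.V :=
  N.source p.start :: p.edges.map N.tgt

/-- The weight of a path: the tropical product, i.e. the sum, of the weights of its edges. -/
noncomputable def Path.weight {N : Network.{u} n} (p : N.Path) (w : N.E → WithBot ℝ) :
    WithBot ℝ :=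
  (p.edges.map w).sum

/-- An `α`-multipath: a collection of `α` pairwise non-intersecting paths, each leading from a
source to a sink. -/
@[ext]
structure Multipath (N : Network.{u} n) (α : ℕ) where
  path : Fin α → N.Path
  nonintersecting : ∀ i j, i ≠ j → List.Disjoint (path i).support (path j).support

/-- The set of vertices of a multipath. -/
def Multipath.support {N : Network.{u} n} {α : ℕ} (p : N.Multipath α) : Set N.V :=
  {v | ∃ i, v ∈ (p.path i).support}

/-- The weight of a multipath. -/
noncomputable def Multipath.weight {N : Network.{u} n} {α : ℕ} (p : N.Multipath α)
    (w : N.E → WithBot ℝ) : WithBot ℝ :=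
  ∑ i, (p.path i).weight w

/-- The `i`-th sink of `N` is to be glued to the `i`-th source of `M`. -/
def Glue (N M : Network.{u} n) (a b : N.V ⊕ M.V) : Prop :=
  ∃ i, a = Sum.inl (N.sink i) ∧ b = Sum.inr (M.source i)

/-- The concatenation `N ∘ M`: `M` is placed to the right of `N` and, for every `i`, the `i`-th
sink of `N` is identified with the `i`-th source of `M`. -/
def concat (N M : Network.{u} n) : Network.{u} n where
  V := Quot (Glue N M)
  E := N.E ⊕ M.E
  finiteV := by
    have := N.finiteV
    have := M.finiteV
    infer_instance
  finiteE := by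
    have := N.finiteE
    have := M.finiteE
    infer_instance
  src := Sum.elim (fun e => Quot.mk _ (Sum.inl (N.src e))) (fun e => Quot.mk _ (Sum.inr (M.src e)))
  tgt := Sum.elim (fun e => Quot.mk _ (Sum.inl (N.tgt e))) (fun e => Quot.mk _ (Sum.inr (M.tgt e)))
  source i := Quot.mk _ (Sum.inl (N.source i))
  sink i := Quot.mk _ (Sum.inr (M.sink i))

/-- A vertex of `N`, seen as a vertex of `N ∘ M`. -/
def inclLeft (N M : Network.{u} n) (v : N.V) : (N.concat M).V :=
  Quot.mk _ (Sum.inl v)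

/-- The weighting `w₁ ∘ w₂` of `N ∘ M`. -/
def concatWeight {N M : Network.{u} n} (w₁ : N.E → WithBot ℝ) (w₂ : M.E → WithBot ℝ) :
    (N.concat M).E → WithBot ℝ :=
  Sum.elim w₁ w₂

/-- An `(α 0, α 1, α 2)`-multipath in `N₁ ∘ N₂ ∘ N₃`: an `α 0`-multipath in `N₁`,
an `α 1`-multipath in `N₁ ∘ N₂` and an `α 2`-multipath in `N₁ ∘ N₂ ∘ N₃` that are pairwise
non-intersecting inside `N₁ ∘ N₂ ∘ N₃`. -/
@[ext]
structure TripleMultipath (N₁ N₂ N₃ : Network.{u} n) (α : Fin 3 → ℕ) where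
  p₁ : N₁.Multipath (α 0)
  p₂ : (N₁.concat N₂).Multipath (α 1)
  p₃ : ((N₁.concat N₂).concat N₃).Multipath (α 2)
  disjoint₁₂ : Disjoint (N₁.inclLeft N₂ '' p₁.support) p₂.support
  disjoint₁₃ :
    Disjoint ((N₁.concat N₂).inclLeft N₃ '' (N₁.inclLeft N₂ '' p₁.support)) p₃.support
  disjoint₂₃ : Disjoint ((N₁.concat N₂).inclLeft N₃ '' p₂.support) p₃.support

/-- The weight of an `(α 0, α 1, α 2)`-multipath. -/
noncomputable def TripleMultipath.weight {N₁ N₂ N₃ : Network.{u} n} {α : Fin 3 → ℕ}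
    (p : TripleMultipath N₁ N₂ N₃ α) (w₁ : N₁.E → WithBot ℝ) (w₂ : N₂.E → WithBot ℝ)
    (w₃ : N₃.E → WithBot ℝ) : WithBot ℝ :=
  p.p₁.weight w₁ + p.p₂.weight (concatWeight w₁ w₂) +
    p.p₃.weight (concatWeight (concatWeight w₁ w₂) w₃)

instance finite_path (N : Network.{u} n) : Finite N.Path := by
  classical
  have := N.finiteE
  have := Fintype.ofFinite N.E
  refine Finite.of_injective
    (fun p : N.Path => ((p.start, p.finish, ⟨p.edges, ?_⟩) :
      Fin n × Fin n × {l : List N.E // l.Nodup})) ?_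
  · exact List.Nodup.of_map _ (List.nodup_cons.1 p.nodup).2
  · intro p q h
    simp only [Prod.mk.injEq, Subtype.mk.injEq] at h
    exact Path.ext h.1 h.2.1 h.2.2

instance finite_multipath (N : Network.{u} n) (α : ℕ) : Finite (N.Multipath α) :=
  Finite.of_injective Multipath.path fun _ _ h => Multipath.ext h

instance finite_tripleMultipath (N₁ N₂ N₃ : Network.{u} n) (α : Fin 3 → ℕ) :
    Finite (TripleMultipath N₁ N₂ N₃ α) := by
  refine Finite.of_injective (fun p => (p.p₁, p.p₂, p.p₃)) ?_
  intro p q h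
  simp only [Prod.mk.injEq] at h
  exact TripleMultipath.ext h.1 h.2.1 h.2.2

end Network

/-- The integer points of the tetrahedron `Δ³(n)`. -/
def Tetrahedron (n : ℕ) : Type :=
  {α : Fin 3 → ℕ // ∑ i, α i ≤ n}

/-- The value `m_α(w₁, w₂, w₃)`: the maximal weight of an `α`-multipath in the concatenation of
three tropically weighted planar networks; it is `-∞` (that is, `⊥`) if there is no
`α`-multipath. -/
noncomputable def maxWeight {n : ℕ} (P₁ P₂ P₃ : PlanarNetwork.{u} n) (w₁ : P₁.E → WithBot ℝ)
    (w₂ : P₂.E → WithBot ℝ) (w₃ : P₃.E → WithBot ℝ) (α : Tetrahedron n) : WithBot ℝ :=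
  letI := Fintype.ofFinite
    (Network.TripleMultipath P₁.toNetwork P₂.toNetwork P₃.toNetwork α.1)
  (Finset.univ : Finset
    (Network.TripleMultipath P₁.toNetwork P₂.toNetwork P₃.toNetwork α.1)).sup
      fun p => p.weight w₁ w₂ w₃

/-- Barycentric coordinates of a point with respect to the vertices
`(0,0,0), (n,0,0), (0,n,0), (0,0,n)` of the tetrahedron (multiplied by `n`). -/
def barycentric (n : ℕ) (p : Fin 3 → ℤ) : Fin 4 → ℤ :=
  Fin.cons ((n : ℤ) - ∑ i, p i) p

/-- The action of `S₄` on the points by permutation of the vertices of the tetrahedron,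
i.e. of the barycentric coordinates. -/
def permAct (n : ℕ) (σ : Equiv.Perm (Fin 4)) (p : Fin 3 → ℤ) : Fin 3 → ℤ :=
  fun i => barycentric n p (σ.symm i.succ)

/-- The four points are the vertices of a small rhombus in `Δ³(n)`, with long diagonal `b₁, b₂`
and short diagonal `a₁, a₂`: they are obtained from `(0,0,0), (1,1,0)` and `(1,0,0), (0,1,0)` by
an element of `S₄` followed by a translation. -/
def IsSmallRhombus {n : ℕ} (b₁ b₂ a₁ a₂ : Tetrahedron n) : Prop :=
  ∃ (σ : Equiv.Perm (Fin 4)) (t : Fin 3 → ℤ),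
    (∀ i, (b₁.1 i : ℤ) = permAct n σ ![0, 0, 0] i + t i) ∧
    (∀ i, (b₂.1 i : ℤ) = permAct n σ ![1, 1, 0] i + t i) ∧
    (∀ i, (a₁.1 i : ℤ) = permAct n σ ![1, 0, 0] i + t i) ∧
    (∀ i, (a₂.1 i : ℤ) = permAct n σ ![0, 1, 0] i + t i)

/-! The inequality is an exchange argument for integral flows. Split every vertex of the triple
concatenation into an entry and an outlet joined by one arc, so that arc-disjoint walks through the
split digraph are vertex-disjoint. Add a terminal `0` in front of the sources and terminals `1`,
`2`, `3` behind the three places where paths may end. An `(i,j,k)`-multipath then becomes a finite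
set of arcs whose boundary vanishes off the terminals and is `i+j+k, -i, -j, -k` on them.
Conversely, since abscissas make the digraph acyclic, every arc set with this boundary decomposes
into such a multipath with no arc left over (`exists_isArcWalk_family`).

The boundary on the terminals is `(n,0,0,0)` minus the barycentric coordinates, so the four vertices
of the tetrahedron enter symmetrically. For a small rhombus, the arc sets `Y` and `X` of multipaths
of kinds `b₁` and `b₂` have boundary difference `X - Y` equal to `2` at one terminal `σ 0` and `-1`
at two others, `σ 1` and `σ 2`. Reverse the arcs of `Y \ X` and follow a walk in the symmetric
difference from `σ 0` to a node of negative boundary, which is `σ 1` or `σ 2`. Interchanging `X` and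
`Y` along this walk moves one unit of boundary (`exists_arcBoundary_exchange`) and leaves arc sets
of the kinds `a₁` and `a₂`, in one order or the other. The arcs are only redistributed, so the total
weight is preserved without subtraction, which `-∞` would forbid. Applying this to maximal
multipaths gives the theorem. -/

/-! ### Boundaries, decomposition and exchange of arc sets in a digraph. -/

section ArcSets

variable {A W M ι : Type*}

/-- The boundary of a finite set of arcs: out-degree minus in-degree at every node. -/
def arcBoundary [DecidableEq W] (tail head : A → W) (X : Finset A) : W → ℤ :=
  ∑ a ∈ X, (Pi.single (tail a) 1 - Pi.single (head a) 1)

/-- The list of arcs `l` is a directed walk from `u` to `v`. -/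
def IsArcWalk (tail head : A → W) : W → List A → W → Prop
  | u, [], v => u = v
  | u, a :: l, v => tail a = u ∧ IsArcWalk tail head (head a) l v

variable [DecidableEq W]

theorem exists_tail_eq_of_arcBoundary_pos {tail head : A → W} {X : Finset A} {u : W}
    (hu : 0 < arcBoundary tail head X u) : ∃ a ∈ X, tail a = u := by
  by_contra! h
  refine hu.not_ge ?_
  rw [arcBoundary, Finset.sum_apply]
  refine Finset.sum_nonpos fun a ha => ?_
  rw [Pi.sub_apply, Pi.single_eq_of_ne (h a ha).symm, zero_sub, Pi.single_apply]
  split <;> simp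

variable [DecidableEq A]

theorem arcBoundary_toFinset_of_isArcWalk {tail head : A → W} {l : List A} {u v : W}
    (hl : IsArcWalk tail head u l v) (hnd : l.Nodup) :
    arcBoundary tail head l.toFinset = Pi.single u 1 - Pi.single v 1 := by
  rw [arcBoundary, List.sum_toFinset _ hnd]
  clear hnd
  induction l generalizing u with
  | nil => cases hl; simp
  | cons a l ih =>
    obtain ⟨rfl, hl⟩ := hl
    rw [List.map_cons, List.sum_cons, ih hl]
    abel

theorem arcBoundary_erase {tail head : A → W} {X : Finset A} {a : A} (ha : a ∈ X) :
    arcBoundary tail head X = arcBoundary tail head (X.erase a) +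
      (Pi.single (tail a) 1 - Pi.single (head a) 1) := by
  rw [arcBoundary, arcBoundary, Finset.sum_erase_add _ _ ha]

/-- From a node with positive boundary a walk inside the arc set leads to a node with negative
boundary. -/
theorem exists_isArcWalk_of_arcBoundary_pos {tail head : A → W} (X : Finset A) {u : W}
    (hu : 0 < arcBoundary tail head X u) :
    ∃ v l, arcBoundary tail head X v < 0 ∧ IsArcWalk tail head u l v ∧ l.Nodup ∧
      ∀ a ∈ l, a ∈ X := by
  induction X using Finset.strongInduction generalizing u with
  | H X ih =>
    obtain ⟨a, ha, rfl⟩ := exists_tail_eq_of_arcBoundary_pos hu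
    by_cases hneg : arcBoundary tail head X (head a) < 0
    · exact ⟨head a, [a], hneg, ⟨rfl, rfl⟩, by simp, by simpa using ha⟩
    have hX : ∀ v, arcBoundary tail head X v = arcBoundary tail head (X.erase a) v +
        ((Pi.single (tail a) 1 : W → ℤ) v - (Pi.single (head a) 1 : W → ℤ) v) := fun v =>
      congrFun (arcBoundary_erase ha) v
    -- Deleting `a` raises the boundary at its head by one; if `a` is a loop, the boundary there is
    -- unchanged and already positive. The walk therefore continues from `head a` in a smaller set.
    -- Deletion also keeps the arcs distinct, so cycles do no harm.
    have hpos : 0 < arcBoundary tail head (X.erase a) (head a) := by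
      have h := hX (head a)
      rw [Pi.single_eq_same] at h
      by_cases hth : tail a = head a
      · rw [hth, Pi.single_eq_same] at h
        rw [hth] at hu
        omega
      · rw [Pi.single_eq_of_ne (Ne.symm hth)] at h
        omega
    obtain ⟨v, l, hv, hl, hnd, hmem⟩ := ih _ (Finset.erase_ssubset ha) hpos
    have hvh : v ≠ head a := by rintro rfl; omega
    refine ⟨v, a :: l, ?_, ⟨rfl, hl⟩, List.nodup_cons.2 ⟨fun h => ?_, hnd⟩, ?_⟩
    · have h := hX v
      rw [Pi.single_eq_of_ne hvh] at h
      by_cases hvt : v = tail a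
      · subst hvt
        rw [Pi.single_eq_same] at h
        omega
      · rw [Pi.single_eq_of_ne hvt] at h
        omega
    · exact (Finset.notMem_erase a X) (hmem a h)
    · intro b hb
      rcases List.mem_cons.1 hb with rfl | hb
      · exact ha
      · exact Finset.mem_of_mem_erase (hmem b hb)

/-- At the head of an arc of maximal head rank, zero boundary would force an arc to leave, and that
arc would have a head of larger rank. -/
theorem eq_empty_of_arcBoundary_eq_zero {tail head : A → W} {rank : W → ℕ}
    (hrank : ∀ a, rank (tail a) < rank (head a)) {X : Finset A}
    (hX : arcBoundary tail head X = 0) : X = ∅ := by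
  by_contra hne
  obtain ⟨a, ha, hmax⟩ := Finset.exists_max_image X (fun a => rank (head a))
    (Finset.nonempty_iff_ne_empty.2 hne)
  have hne : tail a ≠ head a := fun h => (hrank a).ne (by rw [h])
  have hpos : 0 < arcBoundary tail head (X.erase a) (head a) := by
    have h := congrFun (arcBoundary_erase (tail := tail) (head := head) ha) (head a)
    simp only [hX, Pi.zero_apply, Pi.add_apply, Pi.sub_apply, Pi.single_eq_same,
      Pi.single_eq_of_ne hne.symm] at h
    omega
  obtain ⟨b, hb, hba⟩ := exists_tail_eq_of_arcBoundary_pos hpos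
  have h₁ := hmax b (Finset.mem_of_mem_erase hb)
  have h₂ := hrank b
  rw [hba] at h₂
  omega

theorem arcBoundary_sdiff {tail head : A → W} {X Y : Finset A} (h : Y ⊆ X) :
    arcBoundary tail head (X \ Y) = arcBoundary tail head X - arcBoundary tail head Y := by
  rw [eq_sub_iff_add_eq, arcBoundary, arcBoundary, arcBoundary, Finset.sum_sdiff h]

/-- In an acyclic digraph, an arc set with the boundary of a family of walks leaving `s`
decomposes into such a family. -/
theorem exists_isArcWalk_family [DecidableEq ι] [AddCommMonoid M] {tail head : A → W}
    {rank : W → ℕ} (hrank : ∀ a, rank (tail a) < rank (head a)) {s : W} {T : ι → W}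
    (hT : ∀ i, T i ≠ s) (w : A → M) (S : Finset ι) (X : Finset A)
    (hX : arcBoundary tail head X = ∑ i ∈ S, (Pi.single s 1 - Pi.single (T i) 1)) :
    ∃ l : ι → List A, (∀ i ∈ S, IsArcWalk tail head s (l i) (T i)) ∧
      (∀ i ∈ S, ∀ a ∈ l i, a ∈ X) ∧
      (∀ i ∈ S, ∀ j ∈ S, i ≠ j → (l i).Disjoint (l j)) ∧
      ∑ i ∈ S, ((l i).map w).sum = ∑ a ∈ X, w a := by
  induction S using Finset.strongInduction generalizing X with
  | H S ih =>
    rcases S.eq_empty_or_nonempty with rfl | hS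
    · obtain rfl := eq_empty_of_arcBoundary_eq_zero hrank (by simpa using hX)
      exact ⟨fun _ => [], by simp⟩
    have hpos : 0 < arcBoundary tail head X s := by
      rw [hX, Finset.sum_apply]
      refine Finset.sum_pos (fun i _ => ?_) hS
      simp [Pi.single_eq_of_ne (hT i).symm]
    obtain ⟨v, l, hv, hl, hnd, hmem⟩ := exists_isArcWalk_of_arcBoundary_pos X hpos
    have hvs : v ≠ s := by rintro rfl; omega
    -- The prescribed boundary is negative only at ends `T j`, so the walk may be peeled off as the
    -- `j`-th member of the family.
    obtain ⟨j, hj, rfl⟩ : ∃ j ∈ S, T j = v := by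
      by_contra! h
      refine hv.not_ge ?_
      rw [hX, Finset.sum_apply]
      refine Finset.sum_nonneg fun i hi => ?_
      simp [Pi.single_eq_of_ne hvs, Pi.single_eq_of_ne (h i hi).symm]
    have hsub : l.toFinset ⊆ X := fun a ha => hmem a (List.mem_toFinset.1 ha)
    obtain ⟨L, hL, hLX, hLd, hLw⟩ := ih (S.erase j) (Finset.erase_ssubset hj)
      (X \ l.toFinset) (by
        rw [arcBoundary_sdiff hsub, hX, arcBoundary_toFinset_of_isArcWalk hl hnd,
          ← Finset.sum_erase_add _ _ hj, add_sub_cancel_right])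
    have hdis : ∀ i ∈ S, i ≠ j → (L i).Disjoint l := fun i hi hij a ha hal =>
      (Finset.mem_sdiff.1 (hLX i (Finset.mem_erase.2 ⟨hij, hi⟩) a ha)).2
        (List.mem_toFinset.2 hal)
    refine ⟨Function.update L j l, fun i hi => ?_, fun i hi => ?_, fun i hi k hk hik => ?_, ?_⟩
    · by_cases hij : i = j
      · subst hij; simpa using hl
      · simpa [hij] using hL i (Finset.mem_erase.2 ⟨hij, hi⟩)
    · by_cases hij : i = j
      · subst hij; simpa using hmem
      · rw [Function.update_of_ne hij]
        exact fun a ha => (Finset.mem_sdiff.1 (hLX i (Finset.mem_erase.2 ⟨hij, hi⟩) a ha)).1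
    · by_cases hij : i = j
      · subst hij
        rw [Function.update_self, Function.update_of_ne hik.symm]
        exact (hdis k hk hik.symm).symm
      · rw [Function.update_of_ne hij]
        by_cases hkj : k = j
        · subst hkj
          rw [Function.update_self]
          exact hdis i hi hij
        · rw [Function.update_of_ne hkj]
          exact hLd i (Finset.mem_erase.2 ⟨hij, hi⟩) k (Finset.mem_erase.2 ⟨hkj, hk⟩) hik
    · rw [← Finset.sum_erase_add _ _ hj, Function.update_self,
        Finset.sum_congr rfl fun i hi => by
          rw [Function.update_of_ne (Finset.ne_of_mem_erase hi)], hLw,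
        ← List.sum_toFinset _ hnd, Finset.sum_sdiff hsub]

/-- The exchange property of arc sets: if the boundary of `X` exceeds that of `Y` at `u`, then one
unit of boundary can be moved from `u` to some `v` at which the boundary of `Y` exceeds that
of `X`, and back for `Y`, without changing the total weight. -/
theorem exists_arcBoundary_exchange [AddCommMonoid M] {tail head : A → W} (w : A → M)
    (X Y : Finset A) {u : W} (hu : arcBoundary tail head Y u < arcBoundary tail head X u) :
    ∃ v X' Y', arcBoundary tail head X v < arcBoundary tail head Y v ∧
      arcBoundary tail head X' = arcBoundary tail head X - (Pi.single u 1 - Pi.single v 1) ∧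
      arcBoundary tail head Y' = arcBoundary tail head Y + (Pi.single u 1 - Pi.single v 1) ∧
      ∑ a ∈ X', w a + ∑ a ∈ Y', w a = ∑ a ∈ X, w a + ∑ a ∈ Y, w a := by
  -- The residual digraph: arcs of `X` keep their direction and all others are reversed, so a walk
  -- in the symmetric difference runs forward along `X` and backward along `Y`.
  set t : A → W := fun a => if a ∈ X then tail a else head a with ht
  set h : A → W := fun a => if a ∈ X then head a else tail a with hh
  have hsub : ∀ Z Z' : Finset A, Z ⊆ X → Disjoint Z' X →
      arcBoundary t h (Z ∪ Z') = arcBoundary tail head Z - arcBoundary tail head Z' := by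
    intro Z Z' hZ hZ'
    rw [arcBoundary, Finset.sum_union (hZ'.symm.mono_left hZ), sub_eq_add_neg, arcBoundary,
      arcBoundary, ← Finset.sum_neg_distrib]
    congr 1
    · exact Finset.sum_congr rfl fun a ha => by simp [ht, hh, hZ ha]
    · exact Finset.sum_congr rfl fun a ha => by
        simp [ht, hh, Finset.disjoint_left.1 hZ' ha]
  have hsplit : ∀ Z Z' : Finset A, arcBoundary tail head Z =
      arcBoundary tail head (Z \ Z') + arcBoundary tail head (Z ∩ Z') := by
    intro Z Z'
    rw [arcBoundary, arcBoundary, arcBoundary, add_comm, Finset.sum_inter_add_sum_sdiff]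
  have hbd : arcBoundary t h ((X \ Y) ∪ (Y \ X)) =
      arcBoundary tail head X - arcBoundary tail head Y := by
    rw [hsub _ _ Finset.sdiff_subset Finset.sdiff_disjoint, hsplit X Y, hsplit Y X,
      Finset.inter_comm Y X]
    abel
  obtain ⟨v, l, hv, hl, hnd, hmem⟩ := exists_isArcWalk_of_arcBoundary_pos
    (tail := t) (head := h) ((X \ Y) ∪ (Y \ X)) (u := u) (by
      rw [hbd, Pi.sub_apply]; omega)
  set G := l.toFinset with hG
  have hGmem : ∀ a ∈ G, (a ∈ X ∧ a ∉ Y) ∨ (a ∈ Y ∧ a ∉ X) := fun a ha => by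
    simpa using hmem a (List.mem_toFinset.1 ha)
  have hGb : arcBoundary tail head (X ∩ G) - arcBoundary tail head (Y ∩ G) =
      Pi.single u 1 - Pi.single v 1 := by
    rw [← arcBoundary_toFinset_of_isArcWalk hl hnd, ← hG, ← hsub _ _ Finset.inter_subset_left]
    · congr 1
      ext a
      have := hGmem a
      simp only [Finset.mem_union, Finset.mem_inter]
      tauto
    · refine Finset.disjoint_left.2 fun a ha => ?_
      have := hGmem a
      simp only [Finset.mem_inter] at ha
      tauto
  have hd₁ : Disjoint (X \ G) (Y ∩ G) := Finset.disjoint_left.2 fun a ha hb => by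
    simp only [Finset.mem_inter, Finset.mem_sdiff] at ha hb
    tauto
  have hd₂ : Disjoint (Y \ G) (X ∩ G) := Finset.disjoint_left.2 fun a ha hb => by
    simp only [Finset.mem_inter, Finset.mem_sdiff] at ha hb
    tauto
  -- `G` lies in the symmetric difference of `X` and `Y`; both sets have their membership toggled on
  -- `G`.
  refine ⟨v, (X \ G) ∪ (Y ∩ G), (Y \ G) ∪ (X ∩ G), ?_, ?_, ?_, ?_⟩
  · rw [hbd, Pi.sub_apply] at hv
    omega
  · have : arcBoundary tail head ((X \ G) ∪ (Y ∩ G)) =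
        arcBoundary tail head (X \ G) + arcBoundary tail head (Y ∩ G) :=
      Finset.sum_union hd₁
    rw [this, ← hGb, hsplit X G]
    abel
  · have : arcBoundary tail head ((Y \ G) ∪ (X ∩ G)) =
        arcBoundary tail head (Y \ G) + arcBoundary tail head (X ∩ G) :=
      Finset.sum_union hd₂
    rw [this, ← hGb, hsplit Y G]
    abel
  · rw [Finset.sum_union hd₁, Finset.sum_union hd₂, ← Finset.sum_inter_add_sum_sdiff X G,
      ← Finset.sum_inter_add_sum_sdiff Y G]
    abel

end ArcSets

/-! ### Small rhombi in barycentric coordinates. -/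

/-- Barycentric coordinates sum to `n` before and after a permutation, so the translation extends to
a vector of sum zero and the omitted coordinate obeys the same rule as the other three. -/
theorem barycentric_add_permAct {n : ℕ} (σ : Equiv.Perm (Fin 4)) (p t c : Fin 3 → ℤ)
    (h : ∀ i, c i = permAct n σ p i + t i) (j : Fin 4) :
    barycentric n c j = barycentric n p (σ.symm j) +
      (Fin.cons (-∑ i, t i) t : Fin 4 → ℤ) j := by
  refine Fin.cases ?_ (fun i => ?_) j
  · have hsum : ∑ j, barycentric n p (σ.symm j) = n := by
      rw [Equiv.sum_comp σ.symm (barycentric n p), Fin.sum_univ_succ]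
      simp [barycentric]
    rw [Fin.sum_univ_succ] at hsum
    simp only [barycentric, Fin.cons_zero]
    rw [Finset.sum_congr rfl fun i _ => h i, Finset.sum_add_distrib]
    simp only [permAct, barycentric] at hsum ⊢
    linarith
  · simp only [Fin.cons_succ]
    exact h i

/-- The points of a small rhombus in barycentric coordinates. -/
theorem IsSmallRhombus.exists_barycentric {n : ℕ} {b₁ b₂ a₁ a₂ : Tetrahedron n}
    (h : IsSmallRhombus b₁ b₂ a₁ a₂) :
    ∃ σ : Equiv.Perm (Fin 4),
      barycentric n (fun i => (b₂.1 i : ℤ)) = barycentric n (fun i => (b₁.1 i : ℤ)) -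
        (2 : ℤ) • Pi.single (σ 0) 1 + Pi.single (σ 1) 1 + Pi.single (σ 2) 1 ∧
      barycentric n (fun i => (a₁.1 i : ℤ)) = barycentric n (fun i => (b₁.1 i : ℤ)) -
        Pi.single (σ 0) 1 + Pi.single (σ 1) 1 ∧
      barycentric n (fun i => (a₂.1 i : ℤ)) = barycentric n (fun i => (b₁.1 i : ℤ)) -
        Pi.single (σ 0) 1 + Pi.single (σ 2) 1 := by
  obtain ⟨σ, t, h₁, h₂, h₃, h₄⟩ := h
  have hs : ∀ i j : Fin 4, (Pi.single (σ i) 1 : Fin 4 → ℤ) j =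
      (Pi.single i 1 : Fin 4 → ℤ) (σ.symm j) := by
    intro i j
    simp [Pi.single_apply, Equiv.symm_apply_eq]
  refine ⟨σ, funext fun j => ?_, funext fun j => ?_, funext fun j => ?_⟩ <;>
  · simp only [Pi.add_apply, Pi.sub_apply, Pi.smul_apply, hs,
      barycentric_add_permAct σ _ t _ h₁, barycentric_add_permAct σ _ t _ h₂,
      barycentric_add_permAct σ _ t _ h₃, barycentric_add_permAct σ _ t _ h₄]
    generalize σ.symm j = k
    fin_cases k <;> simp [barycentric, Fin.sum_univ_succ] <;> ring

/-! ### The split digraph and its walks. -/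

namespace Network

variable {n : ℕ}

/-- The nodes of the digraph obtained from a network by splitting every vertex into an entry and
an outlet and adding four terminals. -/
inductive SplitNode (N : Network.{u} n)
  | terminal (t : Fin 4)
  | entry (v : N.V)
  | outlet (v : N.V)

/-- The arcs of the split digraph: terminal `0` is joined to the sources, and vertices that may end
a path of kind `t` are joined to terminal `t + 1`. -/
inductive SplitArc (N : Network.{u} n)
  | start (i : Fin n)
  | vertex (v : N.V)
  | edge (e : N.E)
  | arrive (t : Fin 3) (i : Fin n)

noncomputable instance (N : Network.{u} n) : DecidableEq N.SplitNode := Classical.decEq _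

noncomputable instance (N : Network.{u} n) : DecidableEq N.SplitArc := Classical.decEq _

/-- The tail of an arc of the split digraph. -/
def splitTail (N : Network.{u} n) (target : Fin 3 → Fin n → N.V) : N.SplitArc → N.SplitNode
  | .start _ => .terminal 0
  | .vertex v => .entry v
  | .edge e => .outlet (N.src e)
  | .arrive t i => .outlet (target t i)

/-- The head of an arc of the split digraph. -/
def splitHead (N : Network.{u} n) : N.SplitArc → N.SplitNode
  | .start i => .entry (N.source i)
  | .vertex v => .outlet v
  | .edge e => .entry (N.tgt e)
  | .arrive t _ => .terminal t.succ

/-- The weight of an arc of the split digraph. -/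
noncomputable def splitWeight (N : Network.{u} n) (w : N.E → WithBot ℝ) :
    N.SplitArc → WithBot ℝ
  | .edge e => w e
  | _ => 0

theorem exists_rank {N : Network.{u} n} {x : N.V → ℝ} (hx : ∀ e, x (N.src e) < x (N.tgt e))
    (target : Fin 3 → Fin n → N.V) :
    ∃ rank : N.SplitNode → ℕ, ∀ a, rank (N.splitTail target a) < rank (N.splitHead a) := by
  classical
  have := N.finiteV
  have := Fintype.ofFinite N.V
  -- Counting the vertices strictly to the left turns abscissas into natural numbers; doubling
  -- leaves room to put each entry before its outlet.
  set ρ : N.V → ℕ := fun v => (Finset.univ.filter fun z => x z < x v).card with hρ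
  have hlt : ∀ e, ρ (N.src e) < ρ (N.tgt e) := by
    intro e
    refine Finset.card_lt_card ⟨fun z hz => ?_, fun h => ?_⟩
    · simp only [Finset.mem_filter, Finset.mem_univ, true_and] at hz ⊢
      exact hz.trans (hx e)
    · have := h (Finset.mem_filter.2 ⟨Finset.mem_univ (N.src e), hx e⟩)
      simp at this
  have hle : ∀ v, ρ v ≤ Fintype.card N.V := fun v => Finset.card_le_univ _
  refine ⟨fun z => match z with
    | .terminal t => if t = 0 then 0 else 2 * Fintype.card N.V + 3
    | .entry v => 2 * ρ v + 1
    | .outlet v => 2 * ρ v + 2, ?_⟩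
  rintro (i | v | e | ⟨t, i⟩)
  · simp [splitTail, splitHead]
  · simp [splitTail, splitHead]
  · have := hlt e
    simp only [splitTail, splitHead]
    omega
  · have := hle (target t i)
    simp only [splitTail, splitHead, Fin.succ_ne_zero, if_false]
    omega

theorem IsWalk.pairwise_lt {N : Network.{u} n} {x : N.V → ℝ}
    (hx : ∀ e, x (N.src e) < x (N.tgt e)) {l : List N.E} {a b : N.V} (hl : N.IsWalk a l b) :
    ((a :: l.map N.tgt).map x).Pairwise (· < ·) := by
  induction l generalizing a with
  | nil => simp
  | cons e l ih =>
    obtain ⟨rfl, hl⟩ := hl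
    have h := ih hl
    rw [List.map_cons, List.map_cons, List.pairwise_cons]
    refine ⟨fun y hy => ?_, h⟩
    rw [List.map_cons, List.mem_cons] at hy
    rcases hy with rfl | hy
    · exact hx e
    · exact (hx e).trans ((List.pairwise_cons.1 (by simpa using h)).1 y hy)

theorem IsWalk.nodup {N : Network.{u} n} {x : N.V → ℝ}
    (hx : ∀ e, x (N.src e) < x (N.tgt e)) {l : List N.E} {a b : N.V} (hl : N.IsWalk a l b) :
    (a :: l.map N.tgt).Nodup :=
  List.Nodup.of_map x ((hl.pairwise_lt hx).imp fun h => h.ne)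

theorem IsWalk.end_mem {N : Network.{u} n} {l : List N.E} {a b : N.V} (hl : N.IsWalk a l b) :
    b ∈ a :: l.map N.tgt := by
  induction l generalizing a with
  | nil => cases hl; simp
  | cons e l ih => exact List.mem_cons_of_mem _ (ih hl.2)

/-- A directed walk from a source to one of the vertices that may end a path of kind `t`. -/
structure Route (N : Network.{u} n) (target : Fin 3 → Fin n → N.V) (t : Fin 3) where
  start : Fin n
  finish : Fin n
  edges : List N.E
  isWalk : N.IsWalk (N.source start) edges (target t finish)

namespace Route

variable {N : Network.{u} n} {target : Fin 3 → Fin n → N.V} {t : Fin 3}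

/-- The list of vertices of a route. -/
def support (p : N.Route target t) : List N.V :=
  N.source p.start :: p.edges.map N.tgt

/-- The arcs of the split digraph along a list of edges. -/
def edgeArcs (l : List N.E) : List N.SplitArc :=
  l.flatMap fun e => [.edge e, .vertex (N.tgt e)]

/-- The arcs of the split digraph along a route. -/
def arcs (p : N.Route target t) : List N.SplitArc :=
  .start p.start :: .vertex (N.source p.start) :: (edgeArcs p.edges ++ [.arrive t p.finish])

theorem isArcWalk_edgeArcs {l : List N.E} {a : N.V} {j : Fin n}
    (hl : N.IsWalk a l (target t j)) :
    IsArcWalk (N.splitTail target) N.splitHead (.outlet a) (edgeArcs l ++ [.arrive t j])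
      (.terminal t.succ) := by
  induction l generalizing a with
  | nil => cases hl; exact ⟨rfl, rfl⟩
  | cons e l ih =>
    obtain ⟨rfl, hl⟩ := hl
    exact ⟨rfl, rfl, ih hl⟩

theorem isArcWalk_arcs (p : N.Route target t) :
    IsArcWalk (N.splitTail target) N.splitHead (.terminal 0) p.arcs (.terminal t.succ) :=
  ⟨rfl, rfl, isArcWalk_edgeArcs p.isWalk⟩

theorem vertex_mem_arcs {p : N.Route target t} {v : N.V} :
    SplitArc.vertex v ∈ p.arcs ↔ v ∈ p.support := by
  simp [arcs, support, edgeArcs, eq_comm]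

theorem sum_map_splitWeight_arcs (p : N.Route target t) (w : N.E → WithBot ℝ) :
    (p.arcs.map (N.splitWeight w)).sum = (p.edges.map w).sum := by
  have h : ∀ l : List N.E, ((edgeArcs l).map (N.splitWeight w)).sum = (l.map w).sum := by
    intro l
    induction l with
    | nil => rfl
    | cons e l ih =>
      rw [edgeArcs] at ih ⊢
      simp [splitWeight, ih]
  simp [arcs, h, splitWeight]

/-- Routes without common vertices have no common arcs. -/
theorem disjoint_arcs {s : Fin 3} {p : N.Route target t} {q : N.Route target s}
    (h : p.support.Disjoint q.support) : p.arcs.Disjoint q.arcs := by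
  -- Every arc of a route singles out a vertex of its support: the split vertex at its head or, for
  -- the last arc, the target it leaves. A common arc thus gives a common vertex.
  have key : ∀ {t : Fin 3} (p : N.Route target t) (a : N.SplitArc), a ∈ p.arcs →
      (∃ z, (N.splitHead a = .entry z ∨ N.splitHead a = .outlet z) ∧ z ∈ p.support) ∨
        ∃ j, a = .arrive t j ∧ target t j ∈ p.support := by
    intro t p a ha
    simp only [arcs, edgeArcs, List.mem_cons, List.mem_append, List.mem_flatMap,
      List.not_mem_nil, or_false] at ha
    rcases ha with rfl | rfl | ⟨e, he, rfl | rfl⟩ | rfl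
    · exact .inl ⟨_, .inl rfl, by simp [support]⟩
    · exact .inl ⟨_, .inr rfl, by simp [support]⟩
    · exact .inl ⟨_, .inl rfl, List.mem_cons_of_mem _ (List.mem_map_of_mem he)⟩
    · exact .inl ⟨_, .inr rfl, List.mem_cons_of_mem _ (List.mem_map_of_mem he)⟩
    · exact .inr ⟨_, rfl, p.isWalk.end_mem⟩
  intro a ha hb
  rcases key p a ha with ⟨z, hz, hzp⟩ | ⟨j, rfl, hj⟩
  · rcases key q a hb with ⟨y, hy, hyq⟩ | ⟨j, rfl, hj⟩
    · obtain rfl : z = y := by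
        rcases hz with hz | hz <;> rcases hy with hy | hy <;> rw [hz] at hy <;> cases hy <;> rfl
      exact h hzp hyq
    · rcases hz with hz | hz <;> cases hz
  · rcases key q _ hb with ⟨y, hy | hy, hyq⟩ | ⟨k, hk, hkq⟩
    · cases hy
    · cases hy
    · cases hk
      exact h hj hkq

theorem nodup_arcs {x : N.V → ℝ} (hx : ∀ e, x (N.src e) < x (N.tgt e))
    (p : N.Route target t) : p.arcs.Nodup := by
  obtain ⟨rank, hrank⟩ := exists_rank hx target
  have key : ∀ (l : List N.SplitArc) (a b : N.SplitNode),
      IsArcWalk (N.splitTail target) N.splitHead a l b →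
        (∀ c ∈ l, rank a < rank (N.splitHead c)) ∧ l.Nodup := by
    intro l
    induction l with
    | nil => simp
    | cons d l ih =>
      rintro a b ⟨rfl, hl⟩
      obtain ⟨h₁, h₂⟩ := ih _ _ hl
      refine ⟨fun c hc => ?_, List.nodup_cons.2 ⟨fun hd => (h₁ d hd).false, h₂⟩⟩
      rcases List.mem_cons.1 hc with rfl | hc
      · exact hrank c
      · exact (hrank d).trans (h₁ c hc)
  exact (key _ _ _ p.isArcWalk_arcs).2

theorem exists_edgeArcs_of_isArcWalk {a : N.V} {l : List N.SplitArc}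
    (hl : IsArcWalk (N.splitTail target) N.splitHead (.outlet a) l (.terminal t.succ)) :
    ∃ (es : List N.E) (j : Fin n), N.IsWalk a es (target t j) ∧
      l = edgeArcs es ++ [.arrive t j] := by
  -- Strong induction, because each step consumes two arcs: an edge and the vertex arc forced after
  -- it. An arrival ends the walk, as no arc leaves terminals `1`, `2`, `3`.
  induction hk : l.length using Nat.strong_induction_on generalizing l a with
  | _ k ih =>
    rcases l with _ | ⟨b | b | b | ⟨s, j⟩, l⟩
    · cases hl
    · cases hl.1
    · cases hl.1
    · obtain ⟨h, hl⟩ := hl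
      cases h
      rcases l with _ | ⟨c | c | c | c, l⟩
      · cases hl
      · cases hl.1
      · obtain ⟨h, hl⟩ := hl
        cases h
        obtain ⟨es, j, hw, rfl⟩ := ih l.length (by simp [← hk]) hl rfl
        exact ⟨b :: es, j, ⟨rfl, hw⟩, rfl⟩
      · cases hl.1
      · cases hl.1
    · obtain ⟨h, hl⟩ := hl
      cases h
      rcases l with _ | ⟨c | c | c | c, l⟩
      · obtain rfl : s = t := by
          have : (SplitNode.terminal s.succ : N.SplitNode) = .terminal t.succ := hl
          simpa using this
        exact ⟨[], j, rfl, rfl⟩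
      · have : (SplitNode.terminal 0 : N.SplitNode) = .terminal s.succ := hl.1
        simp [eq_comm] at this
      · cases hl.1
      · cases hl.1
      · cases hl.1

theorem exists_of_isArcWalk {l : List N.SplitArc}
    (hl : IsArcWalk (N.splitTail target) N.splitHead (.terminal 0) l (.terminal t.succ)) :
    ∃ p : N.Route target t, p.arcs = l := by
  match l, hl with
  | [], hl =>
    have : (SplitNode.terminal 0 : N.SplitNode) = .terminal t.succ := hl
    simp [eq_comm] at this
  | .start i :: l, ⟨_, hl⟩ =>
    match l, hl with
    | .vertex v :: l, ⟨h, hl⟩ =>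
      cases h
      obtain ⟨es, j, hw, rfl⟩ := exists_edgeArcs_of_isArcWalk hl
      exact ⟨⟨i, j, es, hw⟩, rfl⟩

end Route

/-! ### Systems of routes as arc sets, and their exchange. -/

/-- A family of pairwise non-intersecting routes, `α t` of them of kind `t`. -/
structure RouteSystem (N : Network.{u} n) (target : Fin 3 → Fin n → N.V) (α : Fin 3 → ℕ) where
  route : ∀ i : (t : Fin 3) × Fin (α t), N.Route target i.1
  nonintersecting : ∀ i j, i ≠ j → (route i).support.Disjoint (route j).support

namespace RouteSystem

variable {N : Network.{u} n} {target : Fin 3 → Fin n → N.V} {α : Fin 3 → ℕ}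

/-- The weight of a system of routes. -/
noncomputable def weight (p : N.RouteSystem target α) (w : N.E → WithBot ℝ) : WithBot ℝ :=
  ∑ i, ((p.route i).edges.map w).sum

/-- The boundary of a system of routes in the split digraph. -/
noncomputable def boundary (N : Network.{u} n) (α : Fin 3 → ℕ) : N.SplitNode → ℤ :=
  ∑ i : (t : Fin 3) × Fin (α t), (Pi.single (.terminal 0) 1 - Pi.single (.terminal i.1.succ) 1)

/-- One formula for all four terminals: at terminal `0` the number of routes is `n` minus the
barycentric coordinate there. This is what makes the `S₄`-symmetry visible. -/
theorem boundary_terminal (N : Network.{u} n) (α : Fin 3 → ℕ) (t : Fin 4) :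
    boundary N α (.terminal t) =
      (if t = 0 then (n : ℤ) else 0) - barycentric n (fun i => (α i : ℤ)) t := by
  simp only [boundary, Fintype.sum_sigma, Finset.sum_apply, Pi.sub_apply, Pi.single_apply,
    SplitNode.terminal.injEq]
  refine Fin.cases ?_ (fun s => ?_) t
  · simp [barycentric, eq_comm]
  · simp [barycentric]

theorem boundary_entry (N : Network.{u} n) (α : Fin 3 → ℕ) (v : N.V) :
    boundary N α (.entry v) = 0 := by
  simp [boundary, Finset.sum_apply]

theorem boundary_outlet (N : Network.{u} n) (α : Fin 3 → ℕ) (v : N.V) :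
    boundary N α (.outlet v) = 0 := by
  simp [boundary, Finset.sum_apply]

theorem exists_arcs {x : N.V → ℝ} (hx : ∀ e, x (N.src e) < x (N.tgt e))
    (p : N.RouteSystem target α) (w : N.E → WithBot ℝ) :
    ∃ X : Finset N.SplitArc, arcBoundary (N.splitTail target) N.splitHead X = boundary N α ∧
      ∑ a ∈ X, N.splitWeight w a = p.weight w := by
  have hd : Set.PairwiseDisjoint (Finset.univ : Finset ((t : Fin 3) × Fin (α t)))
      fun i => (p.route i).arcs.toFinset := by
    intro i _ j _ hij
    exact List.disjoint_toFinset_iff_disjoint.2 (Route.disjoint_arcs (p.nonintersecting i j hij))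
  refine ⟨Finset.univ.biUnion fun i => (p.route i).arcs.toFinset, ?_, ?_⟩
  · rw [arcBoundary, Finset.sum_biUnion hd]
    exact Finset.sum_congr rfl fun i _ => arcBoundary_toFinset_of_isArcWalk
      (p.route i).isArcWalk_arcs ((p.route i).nodup_arcs hx)
  · rw [Finset.sum_biUnion hd]
    refine Finset.sum_congr rfl fun i _ => ?_
    rw [List.sum_toFinset _ ((p.route i).nodup_arcs hx), Route.sum_map_splitWeight_arcs]

/-- The walks of the decomposition share no arc, and a route meets `v` exactly when it uses the arc
`vertex v`; hence the routes share no vertex. -/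
theorem exists_of_arcBoundary {x : N.V → ℝ} (hx : ∀ e, x (N.src e) < x (N.tgt e))
    (w : N.E → WithBot ℝ) (X : Finset N.SplitArc)
    (hX : arcBoundary (N.splitTail target) N.splitHead X = boundary N α) :
    ∃ p : N.RouteSystem target α, p.weight w = ∑ a ∈ X, N.splitWeight w a := by
  obtain ⟨rank, hrank⟩ := exists_rank hx target
  obtain ⟨l, hl, -, hd, hw⟩ := exists_isArcWalk_family hrank
    (T := fun i : (t : Fin 3) × Fin (α t) => .terminal i.1.succ)
    (fun i => by simp) (N.splitWeight w) Finset.univ X hX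
  choose p hp using fun i => Route.exists_of_isArcWalk (hl i (Finset.mem_univ i))
  refine ⟨⟨p, fun i j hij v hi hj => ?_⟩, ?_⟩
  · refine hd i (Finset.mem_univ i) j (Finset.mem_univ j) hij (a := .vertex v) ?_ ?_
    · rw [← hp]; exact Route.vertex_mem_arcs.2 hi
    · rw [← hp]; exact Route.vertex_mem_arcs.2 hj
  · rw [← hw]
    exact Finset.sum_congr rfl fun i _ => by rw [← hp, Route.sum_map_splitWeight_arcs]

/-- Exchange between two systems of routes whose kinds form a small rhombus. -/
theorem exists_exchange {x : N.V → ℝ} (hx : ∀ e, x (N.src e) < x (N.tgt e))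
    {b₁ b₂ a₁ a₂ : Tetrahedron n} (h : IsSmallRhombus b₁ b₂ a₁ a₂) (w : N.E → WithBot ℝ)
    (p₁ : N.RouteSystem target b₁.1) (p₂ : N.RouteSystem target b₂.1) :
    ∃ (q₁ : N.RouteSystem target a₁.1) (q₂ : N.RouteSystem target a₂.1),
      q₁.weight w + q₂.weight w = p₁.weight w + p₂.weight w := by
  obtain ⟨σ, hB₂, hA₁, hA₂⟩ := h.exists_barycentric
  obtain ⟨Y, hY, hYw⟩ := p₁.exists_arcs hx w
  obtain ⟨X, hX, hXw⟩ := p₂.exists_arcs hx w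
  -- The difference of the two boundaries at this terminal is `2`.
  have hpos : arcBoundary (N.splitTail target) N.splitHead Y (.terminal (σ 0)) <
      arcBoundary (N.splitTail target) N.splitHead X (.terminal (σ 0)) := by
    rw [hX, hY, boundary_terminal, boundary_terminal, hB₂]
    simp
  obtain ⟨v, X', Y', hv, hX', hY', hw⟩ :=
    exists_arcBoundary_exchange (N.splitWeight w) X Y hpos
  have hbd : ∀ (c : Tetrahedron n) (f : N.SplitNode → ℤ),
      (∀ t, f (.terminal t) = (if t = 0 then (n : ℤ) else 0) -
        barycentric n (fun i => (c.1 i : ℤ)) t) → (∀ z, f (.entry z) = 0) →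
      (∀ z, f (.outlet z) = 0) → f = boundary N c.1 := by
    intro c f h₁ h₂ h₃
    funext z
    rcases z with t | z | z
    · rw [h₁, boundary_terminal]
    · rw [h₂, boundary_entry]
    · rw [h₃, boundary_outlet]
  have hst : ∀ s t : Fin 4, (Pi.single (SplitNode.terminal s) 1 : N.SplitNode → ℤ) (.terminal t) =
      (Pi.single s 1 : Fin 4 → ℤ) t := by
    intro s t
    simp [Pi.single_apply]
  rw [hX, hY] at hv
  rw [hX] at hX'
  rw [hY] at hY'
  obtain ⟨s, rfl⟩ : ∃ s, v = .terminal s := by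
    rcases v with s | z | z
    · exact ⟨s, rfl⟩
    · simp [boundary_entry] at hv
    · simp [boundary_outlet] at hv
  have hs : s = σ 1 ∨ s = σ 2 := by
    by_contra! hne
    rw [boundary_terminal, boundary_terminal, hB₂] at hv
    simp only [Pi.add_apply, Pi.sub_apply, Pi.smul_apply, Pi.single_eq_of_ne hne.1,
      Pi.single_eq_of_ne hne.2, Pi.single_apply, smul_eq_mul] at hv
    split_ifs at hv <;> omega
  -- `Y'` arises from `b₁` by moving one unit from `σ 0` to the end of the walk: it is of kind `a₁`
  -- if that end is `σ 1` and of kind `a₂` if it is `σ 2`. `X'` is of the other kind.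
  rcases hs with rfl | rfl
  · obtain ⟨q₁, hq₁⟩ := exists_of_arcBoundary (target := target) (α := a₁.1) hx w Y' (by
      rw [hY']
      refine hbd a₁ _ (fun t => ?_) (fun z => ?_) (fun z => ?_)
      · simp only [Pi.add_apply, Pi.sub_apply, boundary_terminal, hst, hA₁]
        ring
      · simp [boundary_entry]
      · simp [boundary_outlet])
    obtain ⟨q₂, hq₂⟩ := exists_of_arcBoundary (target := target) (α := a₂.1) hx w X' (by
      rw [hX']
      refine hbd a₂ _ (fun t => ?_) (fun z => ?_) (fun z => ?_)
      · simp only [Pi.add_apply, Pi.sub_apply, boundary_terminal, hst, hA₂, hB₂, Pi.smul_apply,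
          smul_eq_mul]
        ring
      · simp [boundary_entry]
      · simp [boundary_outlet])
    exact ⟨q₁, q₂, by rw [hq₁, hq₂, add_comm, hw, hXw, hYw, add_comm]⟩
  · obtain ⟨q₁, hq₁⟩ := exists_of_arcBoundary (target := target) (α := a₁.1) hx w X' (by
      rw [hX']
      refine hbd a₁ _ (fun t => ?_) (fun z => ?_) (fun z => ?_)
      · simp only [Pi.add_apply, Pi.sub_apply, boundary_terminal, hst, hA₁, hB₂, Pi.smul_apply,
          smul_eq_mul]
        ring
      · simp [boundary_entry]
      · simp [boundary_outlet])
    obtain ⟨q₂, hq₂⟩ := exists_of_arcBoundary (target := target) (α := a₂.1) hx w Y' (by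
      rw [hY']
      refine hbd a₂ _ (fun t => ?_) (fun z => ?_) (fun z => ?_)
      · simp only [Pi.add_apply, Pi.sub_apply, boundary_terminal, hst, hA₂]
        ring
      · simp [boundary_entry]
      · simp [boundary_outlet])
    exact ⟨q₁, q₂, by rw [hq₁, hq₂, hw, hXw, hYw, add_comm]⟩

end RouteSystem

end Network

/-! ### Gradings by abscissa and walks in a concatenation. -/

namespace Network

variable {n : ℕ}

/-- A grading of a network by abscissas: edges lead from left to right, sources are on the left
border and sinks are on the right border. -/
structure IsGraded (N : Network.{u} n) (x : N.V → ℝ) (r : ℝ) : Prop where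
  nonneg : ∀ v, 0 ≤ x v
  le : ∀ v, x v ≤ r
  r_nonneg : 0 ≤ r
  x_source : ∀ i, x (N.source i) = 0
  x_sink : ∀ i, x (N.sink i) = r
  lt : ∀ e, x (N.src e) < x (N.tgt e)
  source_injective : Function.Injective N.source

/-- The abscissas on a concatenation. -/
def concatAbscissa {N M : Network.{u} n} {x : N.V → ℝ} {y : M.V → ℝ} {r s : ℝ}
    (hN : N.IsGraded x r) (hM : M.IsGraded y s) : (N.concat M).V → ℝ :=
  Quot.lift (Sum.elim x fun v => r + y v) (by
    rintro a b ⟨i, rfl, rfl⟩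
    simp [hN.x_sink, hM.x_source])

theorem inclLeft_injective {N M : Network.{u} n} (hM : Function.Injective M.source) :
    Function.Injective (N.inclLeft M) := by
  classical
  -- A retraction undoing the gluing: each source of `M` goes back to the sink of `N` glued to it,
  -- whose index is determined because the sources of `M` are distinct.
  let g : (N.concat M).V → N.V ⊕ M.V := Quot.lift
    (Sum.elim Sum.inl fun v =>
      if h : ∃ i, M.source i = v then Sum.inl (N.sink h.choose) else Sum.inr v) (by
      rintro a b ⟨i, rfl, rfl⟩
      have h : ∃ j, M.source j = M.source i := ⟨i, rfl⟩
      simp only [Sum.elim_inl, Sum.elim_inr, dif_pos h]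
      rw [hM h.choose_spec])
  intro a b hab
  exact Sum.inl_injective (congrArg g hab)

theorem IsGraded.concat {N M : Network.{u} n} {x : N.V → ℝ} {y : M.V → ℝ} {r s : ℝ}
    (hN : N.IsGraded x r) (hM : M.IsGraded y s) :
    (N.concat M).IsGraded (concatAbscissa hN hM) (r + s) where
  nonneg v := by
    induction v using Quot.ind with
    | mk a =>
      rcases a with v | v
      · exact hN.nonneg v
      · exact add_nonneg hN.r_nonneg (hM.nonneg v)
  le v := by
    induction v using Quot.ind with
    | mk a =>
      rcases a with v | v
      · exact (hN.le v).trans (le_add_of_nonneg_right hM.r_nonneg)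
      · exact add_le_add_right (hM.le v) r
  r_nonneg := add_nonneg hN.r_nonneg hM.r_nonneg
  x_source i := hN.x_source i
  x_sink i := congrArg (r + ·) (hM.x_sink i)
  lt e := by
    rcases e with e | e
    · exact hN.lt e
    · exact add_lt_add_right (hM.lt e) r
  source_injective := (inclLeft_injective hM.source_injective).comp hN.source_injective

/-- An edge of `N`, seen as an edge of `N ∘ M`. -/
def inclEdge (N M : Network.{u} n) (e : N.E) : (N.concat M).E :=
  Sum.inl e

theorem IsWalk.concat_left {N : Network.{u} n} (M : Network.{u} n) {l : List N.E} {a b : N.V}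
    (hl : N.IsWalk a l b) :
    (N.concat M).IsWalk (N.inclLeft M a) (l.map (N.inclEdge M)) (N.inclLeft M b) := by
  induction l generalizing a with
  | nil => exact congrArg _ hl
  | cons e l ih => exact ⟨congrArg (N.inclLeft M) hl.1, ih hl.2⟩

theorem map_tgt_map_inclEdge (N M : Network.{u} n) (l : List N.E) :
    (l.map (N.inclEdge M)).map (N.concat M).tgt = (l.map N.tgt).map (N.inclLeft M) := by
  simp only [List.map_map]
  rfl

theorem map_concatWeight_map_inclEdge {N M : Network.{u} n} (l : List N.E)
    (w : N.E → WithBot ℝ) (w' : M.E → WithBot ℝ) :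
    (l.map (N.inclEdge M)).map (concatWeight w w') = l.map w := by
  simp only [List.map_map]
  rfl

theorem IsWalk.le {N : Network.{u} n} {x : N.V → ℝ} {r : ℝ} (hN : N.IsGraded x r)
    {l : List N.E} {a b : N.V} (hl : N.IsWalk a l b) : x a ≤ x b := by
  induction l generalizing a with
  | nil => cases hl; exact le_rfl
  | cons e l ih =>
    obtain ⟨rfl, hl⟩ := hl
    exact (hN.lt e).le.trans (ih hl)

/-- A walk in `N ∘ M` between vertices of `N` is a walk in `N`. -/
theorem IsWalk.of_concat_left {N M : Network.{u} n} {x : N.V → ℝ} {y : M.V → ℝ} {r s : ℝ}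
    (hN : N.IsGraded x r) (hM : M.IsGraded y s) {l : List (N.concat M).E} {a b : N.V}
    (hl : (N.concat M).IsWalk (N.inclLeft M a) l (N.inclLeft M b)) :
    ∃ l', l'.map (N.inclEdge M) = l ∧ N.IsWalk a l' b := by
  induction l generalizing a with
  | nil => exact ⟨[], rfl, inclLeft_injective hM.source_injective hl⟩
  | cons e l ih =>
    obtain ⟨h, hl⟩ := hl
    rcases e with e | e
    · obtain ⟨l', rfl, hl'⟩ := ih hl
      exact ⟨e :: l', rfl, inclLeft_injective hM.source_injective h, hl'⟩
    -- The head of an edge of `M` lies strictly to the right of `N`, and walks never return to the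
    -- left.
    · exfalso
      have h₁ : r + y (M.tgt e) ≤ x b := hl.le (hN.concat hM)
      have h₂ := hM.lt e
      have h₃ := hM.nonneg (M.src e)
      have h₄ := hN.le b
      linarith

/-! ### Triple multipaths as systems of routes. -/

/-- The vertices of `N₁ ∘ N₂ ∘ N₃` at which the paths of a triple multipath end. -/
def tripleTarget (N₁ N₂ N₃ : Network.{u} n) :
    Fin 3 → Fin n → ((N₁.concat N₂).concat N₃).V
  | 0 => fun i => (N₁.concat N₂).inclLeft N₃ (N₁.inclLeft N₂ (N₁.sink i))
  | 1 => fun i => (N₁.concat N₂).inclLeft N₃ ((N₁.concat N₂).sink i)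
  | 2 => ((N₁.concat N₂).concat N₃).sink

section Triple

variable {N₁ N₂ N₃ : Network.{u} n}

/-- A path in `N₁` as a route in the triple concatenation. -/
def Path.toRouteZero (p : N₁.Path) :
    ((N₁.concat N₂).concat N₃).Route (tripleTarget N₁ N₂ N₃) 0 where
  start := p.start
  finish := p.finish
  edges := (p.edges.map (N₁.inclEdge N₂)).map ((N₁.concat N₂).inclEdge N₃)
  isWalk := (p.isWalk.concat_left N₂).concat_left N₃

/-- A path in `N₁ ∘ N₂` as a route in the triple concatenation. -/
def Path.toRouteOne (p : (N₁.concat N₂).Path) :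
    ((N₁.concat N₂).concat N₃).Route (tripleTarget N₁ N₂ N₃) 1 where
  start := p.start
  finish := p.finish
  edges := p.edges.map ((N₁.concat N₂).inclEdge N₃)
  isWalk := p.isWalk.concat_left N₃

/-- A path in the triple concatenation as a route. -/
def Path.toRouteTwo (p : ((N₁.concat N₂).concat N₃).Path) :
    ((N₁.concat N₂).concat N₃).Route (tripleTarget N₁ N₂ N₃) 2 where
  start := p.start
  finish := p.finish
  edges := p.edges
  isWalk := p.isWalk

theorem Path.support_toRouteZero (p : N₁.Path) :
    (p.toRouteZero (N₂ := N₂) (N₃ := N₃)).support =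
      (p.support.map (N₁.inclLeft N₂)).map ((N₁.concat N₂).inclLeft N₃) := by
  simp only [Route.support, Path.toRouteZero, map_tgt_map_inclEdge, Path.support, List.map_cons]
  rfl

theorem Path.support_toRouteOne (p : (N₁.concat N₂).Path) :
    (p.toRouteOne (N₃ := N₃)).support = p.support.map ((N₁.concat N₂).inclLeft N₃) := by
  simp only [Route.support, Path.toRouteOne, map_tgt_map_inclEdge, Path.support, List.map_cons]
  rfl

theorem Path.support_toRouteTwo (p : ((N₁.concat N₂).concat N₃).Path) :
    p.toRouteTwo.support = p.support := rfl

theorem Path.exists_toRouteZero {x₁ : N₁.V → ℝ} {x₂ : N₂.V → ℝ} {x₃ : N₃.V → ℝ} {r₁ r₂ r₃ : ℝ}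
    (h₁ : N₁.IsGraded x₁ r₁) (h₂ : N₂.IsGraded x₂ r₂) (h₃ : N₃.IsGraded x₃ r₃)
    (q : ((N₁.concat N₂).concat N₃).Route (tripleTarget N₁ N₂ N₃) 0) :
    ∃ p : N₁.Path, p.toRouteZero = q := by
  obtain ⟨i, j, l, hl⟩ := q
  obtain ⟨l, rfl, hl'⟩ := IsWalk.of_concat_left (h₁.concat h₂) h₃ hl
  obtain ⟨l, rfl, hl''⟩ := IsWalk.of_concat_left h₁ h₂ hl'
  exact ⟨⟨i, j, l, hl'', hl''.nodup h₁.lt⟩, rfl⟩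

theorem Path.exists_toRouteOne {x₁ : N₁.V → ℝ} {x₂ : N₂.V → ℝ} {x₃ : N₃.V → ℝ} {r₁ r₂ r₃ : ℝ}
    (h₁ : N₁.IsGraded x₁ r₁) (h₂ : N₂.IsGraded x₂ r₂) (h₃ : N₃.IsGraded x₃ r₃)
    (q : ((N₁.concat N₂).concat N₃).Route (tripleTarget N₁ N₂ N₃) 1) :
    ∃ p : (N₁.concat N₂).Path, p.toRouteOne = q := by
  obtain ⟨i, j, l, hl⟩ := q
  obtain ⟨l, rfl, hl'⟩ := IsWalk.of_concat_left (h₁.concat h₂) h₃ hl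
  exact ⟨⟨i, j, l, hl', hl'.nodup (h₁.concat h₂).lt⟩, rfl⟩

theorem Path.exists_toRouteTwo {x : ((N₁.concat N₂).concat N₃).V → ℝ} {r : ℝ}
    (h : ((N₁.concat N₂).concat N₃).IsGraded x r)
    (q : ((N₁.concat N₂).concat N₃).Route (tripleTarget N₁ N₂ N₃) 2) :
    ∃ p : ((N₁.concat N₂).concat N₃).Path, p.toRouteTwo = q :=
  ⟨⟨q.start, q.finish, q.edges, q.isWalk, q.isWalk.nodup h.lt⟩, rfl⟩

variable {α : Fin 3 → ℕ}

/-- The routes of a triple of multipaths. -/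
def tripleRoute (p₁ : N₁.Multipath (α 0)) (p₂ : (N₁.concat N₂).Multipath (α 1))
    (p₃ : ((N₁.concat N₂).concat N₃).Multipath (α 2)) :
    ∀ i : (t : Fin 3) × Fin (α t),
      ((N₁.concat N₂).concat N₃).Route (tripleTarget N₁ N₂ N₃) i.1
  | ⟨0, i⟩ => (p₁.path i).toRouteZero
  | ⟨1, i⟩ => (p₂.path i).toRouteOne
  | ⟨2, i⟩ => (p₃.path i).toRouteTwo

theorem sum_tripleRoute (p₁ : N₁.Multipath (α 0)) (p₂ : (N₁.concat N₂).Multipath (α 1))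
    (p₃ : ((N₁.concat N₂).concat N₃).Multipath (α 2)) (w₁ : N₁.E → WithBot ℝ)
    (w₂ : N₂.E → WithBot ℝ) (w₃ : N₃.E → WithBot ℝ) :
    ∑ i, ((tripleRoute p₁ p₂ p₃ i).edges.map
        (concatWeight (concatWeight w₁ w₂) w₃)).sum =
      p₁.weight w₁ + p₂.weight (concatWeight w₁ w₂) +
        p₃.weight (concatWeight (concatWeight w₁ w₂) w₃) := by
  rw [Fintype.sum_sigma, Fin.sum_univ_three]
  simp only [tripleRoute, Path.toRouteZero, Path.toRouteOne, Path.toRouteTwo,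
    map_concatWeight_map_inclEdge]
  rfl

/-- A triple multipath as a system of routes. -/
theorem TripleMultipath.exists_routeSystem (h₂ : Function.Injective N₂.source)
    (h₃ : Function.Injective N₃.source) (p : TripleMultipath N₁ N₂ N₃ α)
    (w₁ : N₁.E → WithBot ℝ) (w₂ : N₂.E → WithBot ℝ) (w₃ : N₃.E → WithBot ℝ) :
    ∃ q : ((N₁.concat N₂).concat N₃).RouteSystem (tripleTarget N₁ N₂ N₃) α,
      q.weight (concatWeight (concatWeight w₁ w₂) w₃) = p.weight w₁ w₂ w₃ := by
  have inj₁ := inclLeft_injective (N := N₁) h₂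
  have inj₂ := inclLeft_injective (N := N₁.concat N₂) h₃
  have d₁₂ : ∀ i j, (p.p₁.path i).toRouteZero.support.Disjoint
      ((p.p₂.path j).toRouteOne (N₃ := N₃)).support := by
    intro i j
    rw [Path.support_toRouteZero, Path.support_toRouteOne]
    refine List.disjoint_map inj₂ fun v hi hj => ?_
    obtain ⟨z, hz, rfl⟩ := List.mem_map.1 hi
    exact Set.disjoint_left.1 p.disjoint₁₂ ⟨z, ⟨i, hz⟩, rfl⟩ ⟨j, hj⟩
  have d₁₃ : ∀ i j, (p.p₁.path i).toRouteZero.support.Disjoint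
      (p.p₃.path j).toRouteTwo.support := by
    intro i j
    rw [Path.support_toRouteZero, Path.support_toRouteTwo]
    intro v hi hj
    obtain ⟨z', hz', rfl⟩ := List.mem_map.1 hi
    obtain ⟨z, hz, rfl⟩ := List.mem_map.1 hz'
    exact Set.disjoint_left.1 p.disjoint₁₃ ⟨_, ⟨z, ⟨i, hz⟩, rfl⟩, rfl⟩ ⟨j, hj⟩
  have d₂₃ : ∀ i j, (p.p₂.path i).toRouteOne.support.Disjoint
      (p.p₃.path j).toRouteTwo.support := by
    intro i j
    rw [Path.support_toRouteOne, Path.support_toRouteTwo]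
    intro v hi hj
    obtain ⟨z, hz, rfl⟩ := List.mem_map.1 hi
    exact Set.disjoint_left.1 p.disjoint₂₃ ⟨z, ⟨i, hz⟩, rfl⟩ ⟨j, hj⟩
  refine ⟨⟨tripleRoute p.p₁ p.p₂ p.p₃, ?_⟩, sum_tripleRoute _ _ _ _ _ _⟩
  rintro ⟨s, i⟩ ⟨t, j⟩ hij
  match s, t, i, j, hij with
  | 0, 0, i, j, hij =>
    change (p.p₁.path i).toRouteZero.support.Disjoint (p.p₁.path j).toRouteZero.support
    rw [Path.support_toRouteZero, Path.support_toRouteZero]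
    exact List.disjoint_map inj₂ (List.disjoint_map inj₁
      (p.p₁.nonintersecting i j fun h => hij (by rw [h])))
  | 0, 1, i, j, _ => exact d₁₂ i j
  | 0, 2, i, j, _ => exact d₁₃ i j
  | 1, 0, i, j, _ => exact (d₁₂ j i).symm
  | 1, 1, i, j, hij =>
    change (p.p₂.path i).toRouteOne.support.Disjoint (p.p₂.path j).toRouteOne.support
    rw [Path.support_toRouteOne, Path.support_toRouteOne]
    exact List.disjoint_map inj₂ (p.p₂.nonintersecting i j fun h => hij (by rw [h]))
  | 1, 2, i, j, _ => exact d₂₃ i j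
  | 2, 0, i, j, _ => exact (d₁₃ j i).symm
  | 2, 1, i, j, _ => exact (d₂₃ j i).symm
  | 2, 2, i, j, hij => exact p.p₃.nonintersecting i j fun h => hij (by rw [h])

/-- A system of routes in the triple concatenation comes from a triple multipath. -/
theorem RouteSystem.exists_tripleMultipath {x₁ : N₁.V → ℝ} {x₂ : N₂.V → ℝ} {x₃ : N₃.V → ℝ}
    {r₁ r₂ r₃ : ℝ} (h₁ : N₁.IsGraded x₁ r₁) (h₂ : N₂.IsGraded x₂ r₂) (h₃ : N₃.IsGraded x₃ r₃)
    (q : ((N₁.concat N₂).concat N₃).RouteSystem (tripleTarget N₁ N₂ N₃) α)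
    (w₁ : N₁.E → WithBot ℝ) (w₂ : N₂.E → WithBot ℝ) (w₃ : N₃.E → WithBot ℝ) :
    ∃ p : TripleMultipath N₁ N₂ N₃ α,
      p.weight w₁ w₂ w₃ = q.weight (concatWeight (concatWeight w₁ w₂) w₃) := by
  choose f₁ hf₁ using fun i => Path.exists_toRouteZero h₁ h₂ h₃ (q.route ⟨0, i⟩)
  choose f₂ hf₂ using fun i => Path.exists_toRouteOne h₁ h₂ h₃ (q.route ⟨1, i⟩)
  choose f₃ hf₃ using fun i =>
    Path.exists_toRouteTwo ((h₁.concat h₂).concat h₃) (q.route ⟨2, i⟩)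
  have m₁ : ∀ {i v}, v ∈ (f₁ i).support → (N₁.concat N₂).inclLeft N₃ (N₁.inclLeft N₂ v) ∈
      (q.route ⟨0, i⟩).support := by
    intro i v hv
    rw [← hf₁, Path.support_toRouteZero]
    exact List.mem_map_of_mem (List.mem_map_of_mem hv)
  have m₂ : ∀ {i v}, v ∈ (f₂ i).support → (N₁.concat N₂).inclLeft N₃ v ∈
      (q.route ⟨1, i⟩).support := by
    intro i v hv
    rw [← hf₂, Path.support_toRouteOne]
    exact List.mem_map_of_mem hv
  have m₃ : ∀ {i v}, v ∈ (f₃ i).support → v ∈ (q.route ⟨2, i⟩).support := by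
    intro i v hv
    rw [← hf₃]
    exact hv
  have ne : ∀ {t : Fin 3} {i j : Fin (α t)}, i ≠ j →
      (⟨t, i⟩ : (t : Fin 3) × Fin (α t)) ≠ ⟨t, j⟩ := by
    intro t i j hij h
    exact hij (by simpa using h)
  have hq : ∀ {i j : (t : Fin 3) × Fin (α t)} {v}, i ≠ j → v ∈ (q.route i).support →
      v ∈ (q.route j).support → False := fun hij hi hj => q.nonintersecting _ _ hij hi hj
  let p : TripleMultipath N₁ N₂ N₃ α :=
    { p₁ := ⟨f₁, fun i j hij v hi hj => hq (ne hij) (m₁ hi) (m₁ hj)⟩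
      p₂ := ⟨f₂, fun i j hij v hi hj => hq (ne hij) (m₂ hi) (m₂ hj)⟩
      p₃ := ⟨f₃, fun i j hij v hi hj => hq (ne hij) (m₃ hi) (m₃ hj)⟩
      disjoint₁₂ := by
        refine Set.disjoint_left.2 ?_
        rintro _ ⟨v, ⟨i, hi⟩, rfl⟩ ⟨j, hj⟩
        exact hq (by simp) (m₁ hi) (m₂ hj)
      disjoint₁₃ := by
        refine Set.disjoint_left.2 ?_
        rintro _ ⟨_, ⟨v, ⟨i, hi⟩, rfl⟩, rfl⟩ ⟨j, hj⟩
        exact hq (by simp) (m₁ hi) (m₃ hj)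
      disjoint₂₃ := by
        refine Set.disjoint_left.2 ?_
        rintro _ ⟨v, ⟨i, hi⟩, rfl⟩ ⟨j, hj⟩
        exact hq (by simp) (m₂ hi) (m₃ hj) }
  refine ⟨p, ?_⟩
  -- The chosen paths reproduce the given routes exactly, so the weights agree without a separate
  -- computation.
  have hr : tripleRoute p.p₁ p.p₂ p.p₃ = q.route := by
    funext ⟨t, i⟩
    match t, i with
    | 0, i => exact hf₁ i
    | 1, i => exact hf₂ i
    | 2, i => exact hf₃ i
  rw [RouteSystem.weight, ← hr, sum_tripleRoute]
  rfl

end Triple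

end Network

theorem PlanarNetwork.isGraded {n : ℕ} (P : PlanarNetwork.{u} n) :
    P.toNetwork.IsGraded P.x P.r where
  nonneg v := (P.x_mem v).1
  le v := (P.x_mem v).2
  r_nonneg := P.r_pos.le
  x_source i := (P.x_eq_zero_iff _).2 ⟨i, rfl⟩
  x_sink i := (P.x_eq_r_iff _).2 ⟨i, rfl⟩
  lt := P.left_to_right
  source_injective := fun _ _ h => P.source_strictMono.injective (congrArg P.y h)

/-! ### Attainment of the maximum and the rhombus inequality. -/

section MaxWeight

variable {n : ℕ} (P₁ P₂ P₃ : PlanarNetwork.{u} n) (w₁ : P₁.E → WithBot ℝ)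
  (w₂ : P₂.E → WithBot ℝ) (w₃ : P₃.E → WithBot ℝ) {α : Tetrahedron n}

theorem weight_le_maxWeight
    (p : Network.TripleMultipath P₁.toNetwork P₂.toNetwork P₃.toNetwork α.1) :
    p.weight w₁ w₂ w₃ ≤ maxWeight P₁ P₂ P₃ w₁ w₂ w₃ α := by
  let _ := Fintype.ofFinite
    (Network.TripleMultipath P₁.toNetwork P₂.toNetwork P₃.toNetwork α.1)
  exact Finset.le_sup (f := fun p : Network.TripleMultipath P₁.toNetwork P₂.toNetwork
    P₃.toNetwork α.1 => p.weight w₁ w₂ w₃) (Finset.mem_univ p)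

theorem maxWeight_eq_bot_or_exists :
    maxWeight P₁ P₂ P₃ w₁ w₂ w₃ α = ⊥ ∨
      ∃ p : Network.TripleMultipath P₁.toNetwork P₂.toNetwork P₃.toNetwork α.1,
        maxWeight P₁ P₂ P₃ w₁ w₂ w₃ α = p.weight w₁ w₂ w₃ := by
  let _ := Fintype.ofFinite
    (Network.TripleMultipath P₁.toNetwork P₂.toNetwork P₃.toNetwork α.1)
  rcases (Finset.univ : Finset (Network.TripleMultipath P₁.toNetwork P₂.toNetwork
    P₃.toNetwork α.1)).eq_empty_or_nonempty with h | h
  · left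
    change Finset.sup Finset.univ _ = _
    rw [h, Finset.sup_empty]
  · right
    obtain ⟨p, -, hp⟩ := Finset.exists_mem_eq_sup _ h fun p => p.weight w₁ w₂ w₃
    exact ⟨p, hp⟩

end MaxWeight

theorem mainTheorem1 {n : ℕ} (P₁ P₂ P₃ : PlanarNetwork.{u} n)
    (w₁ : P₁.E → WithBot ℝ) (w₂ : P₂.E → WithBot ℝ) (w₃ : P₃.E → WithBot ℝ)
    (b₁ b₂ a₁ a₂ : Tetrahedron n) (h : IsSmallRhombus b₁ b₂ a₁ a₂) :
    maxWeight P₁ P₂ P₃ w₁ w₂ w₃ b₁ + maxWeight P₁ P₂ P₃ w₁ w₂ w₃ b₂ ≤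
      maxWeight P₁ P₂ P₃ w₁ w₂ w₃ a₁ + maxWeight P₁ P₂ P₃ w₁ w₂ w₃ a₂ := by
  have g₁ := P₁.isGraded
  have g₂ := P₂.isGraded
  have g₃ := P₃.isGraded
  -- If either maximum on the long diagonal is `⊥`, the left side is `⊥`; otherwise both are
  -- attained and the exchange applies to maximal multipaths.
  rcases maxWeight_eq_bot_or_exists P₁ P₂ P₃ w₁ w₂ w₃ (α := b₁) with h₁ | ⟨p₁, h₁⟩
  · rw [h₁, WithBot.bot_add]
    exact bot_le
  rcases maxWeight_eq_bot_or_exists P₁ P₂ P₃ w₁ w₂ w₃ (α := b₂) with h₂ | ⟨p₂, h₂⟩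
  · rw [h₂, WithBot.add_bot]
    exact bot_le
  obtain ⟨s₁, hs₁⟩ :=
    p₁.exists_routeSystem g₂.source_injective g₃.source_injective w₁ w₂ w₃
  obtain ⟨s₂, hs₂⟩ :=
    p₂.exists_routeSystem g₂.source_injective g₃.source_injective w₁ w₂ w₃
  obtain ⟨t₁, t₂, ht⟩ :=
    Network.RouteSystem.exists_exchange ((g₁.concat g₂).concat g₃).lt h _ s₁ s₂
  obtain ⟨q₁, hq₁⟩ := t₁.exists_tripleMultipath g₁ g₂ g₃ w₁ w₂ w₃
  obtain ⟨q₂, hq₂⟩ := t₂.exists_tripleMultipath g₁ g₂ g₃ w₁ w₂ w₃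
  rw [h₁, h₂, ← hs₁, ← hs₂, ← ht, ← hq₁, ← hq₂]
  exact add_le_add (weight_le_maxWeight P₁ P₂ P₃ w₁ w₂ w₃ q₁)
    (weight_le_maxWeight P₁ P₂ P₃ w₁ w₂ w₃ q₂)
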